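/- **Setting.** Work on the triangular lattice having horizontal lattice lines, made up of up-pointing and down-pointing unit triangles. A *lozenge* is the union of two unit triangles sharing an edge, and a region is *tileable* if it admits at least one lozenge tiling. A *bowtie* of type $(a,a')$, with $a,a'\ge 0$ integers, is the union of a down-pointing lattice triangle of side $a$ and an up-pointing lattice triangle of side $a'$ (its *lobes*; a lobe of side $0$ is a single point) sharing a vertex, the *node* of the bowtie. A *triad hexagon* $R=R_{x,y,z}^{A,B,C}(a,b,c,a',b',c')$, with $x,y,z,a,b,c,a',b',c'\ge 0$ integers, is the region obtained from a lattice hexagon with side-lengths $x+a+b+c$, $y+a'+b'+c'$, $z+a+b+c$, $x+a'+b'+c'$, $y+a+b+c$, $z+a'+b'+c'$ (clockwise from the northern side) by removing three bowties of types $(a,a')$, $(b,b')$, $(c,c')$ contained in the (closed) hexagon, with nodes $A$ (top), $B$ (left), $C$ (right), such that $A,B,C$ are the vertices of an up-pointing lattice triangle (possibly reduced to a point), the up-pointing lobes lie at the three angles of this triangle, and the side-length $f$ of this triangle satisfies $f\ge a'+b'+c'$. The northern, northeastern, southeastern, southern, southwestern and northwestern sides of the hexagon are denoted $N,NE,SE,S,SW,NW$.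 Let $\delta(\cdot,\cdot)$ denote the distance, in lattice spacings (the distance between two consecutive parallel lattice lines), between the lines supporting two parallel segments. The *S-depth*, *NE-depth* and *NW-depth* of $R$ are $$\delta(BC,S)-b-c,\qquad \delta(AC,NE)-a-c,\qquad \delta(AB,NW)-a-b,$$ respectively. *Squeezing out the $(a,a')$-bowtie $d$ units*, where $0\le d\le a'$, means: keep $A$ fixed and replace the $(a,a')$-bowtie by an $(a+d,a'-d)$-bowtie; translate the $(b,b')$- and $(c,c')$-bowties $d$ units in the directions $\overrightarrow{BA}$ and $\overrightarrow{CA}$, respectively; push out by $d$ lattice spacings the three sides $NW,N,NE$ of the hexagon, and pull in by $d$ lattice spacings the other three sides. Squeezing out the $(b,b')$-bowtie (which pushes out $NW,SW,S$) and the $(c,c')$-bowtie (which pushes out $NE,SE,S$) is defined by symmetry. The inverse operation is called *squeezing in* (for the $(a,a')$-bowtie it is defined for $0\le d\le a$). Both are called *bowtie squeezings*. **Lemma (label tileability).** (a) A triad hexagon is tileable if and only if its S-, NE- and NW-depths are all non-negative. (b) The three depths of a triad hexagon are invariant under bowtie squeezing. (c) If a triad hexagon is tileable, then every region obtained from it by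 a finite sequence of bowtie squeezings is again a triad hexagon and is tileable. -/

import Mathlib

/-!
The triangular lattice has the lattice points `(i, j) : ℤ × ℤ`, standing for the point
`i • e₁ + j • e₂` of the plane with `e₁ = (1, 0)` (east) and `e₂ = (1/2, √3/2)`.
Its lattice lines are the horizontal lines `j = const`, the lines `i = const` (parallel to `e₂`),
and the lines `i + j = const` (parallel to `e₁ - e₂`). In each of the three families, consecutive
lines are one lattice spacing apart, so the distance in lattice spacings between two parallel
lattice lines is the difference of the two constants.
-/

namespace TriadHexagon

/-- Unit triangles of the triangular lattice. `up i j` is the up-pointing one with bottom left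
vertex `(i, j)`; `down i j` is the down-pointing one that shares with `up i j` the edge joining
`(i + 1, j)` and `(i, j + 1)`. -/
inductive UnitTriangle : Type where
  | up (i j : ℤ) : UnitTriangle
  | down (i j : ℤ) : UnitTriangle

/-- The three vertices of a unit triangle. -/
def UnitTriangle.vertices : UnitTriangle → Finset (ℤ × ℤ)
  | .up i j => {(i, j), (i + 1, j), (i, j + 1)}
  | .down i j => {(i + 1, j), (i, j + 1), (i + 1, j + 1)}

/-- A lozenge is the union of two unit triangles that share an edge (exactly two vertices). -/
def IsLozenge (L : Set UnitTriangle) : Prop :=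
  ∃ s t : UnitTriangle, (s.vertices ∩ t.vertices).card = 2 ∧ L = {s, t}

/-- `T` is a lozenge tiling of the region `R` (a set of unit triangles): a set of lozenges
contained in `R` which cover every unit triangle of `R` exactly once. -/
def IsLozengeTiling (R : Set UnitTriangle) (T : Set (Set UnitTriangle)) : Prop :=
  (∀ L ∈ T, IsLozenge L ∧ L ⊆ R) ∧ ∀ t ∈ R, ∃! L, L ∈ T ∧ t ∈ L

/-- Lattice points of the closed up-pointing lattice triangle of side `n` with bottom left
vertex `P`. Its vertices are `P`, `P + (n, 0)`, `P + (0, n)`; for `n = 0` it is just `P`. -/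
def upPoints (P : ℤ × ℤ) (n : ℕ) : Set (ℤ × ℤ) :=
  {Q | P.1 ≤ Q.1 ∧ P.2 ≤ Q.2 ∧ Q.1 + Q.2 ≤ P.1 + P.2 + n}

/-- Lattice points of the closed down-pointing lattice triangle of side `n` with bottom
vertex `P`. Its vertices are `P`, `P + (0, n)`, `P + (-n, n)`; for `n = 0` it is just `P`. -/
def downPoints (P : ℤ × ℤ) (n : ℕ) : Set (ℤ × ℤ) :=
  {Q | Q.1 ≤ P.1 ∧ Q.2 ≤ P.2 + n ∧ P.1 + P.2 ≤ Q.1 + Q.2}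

/-- The unit triangles contained in the closed convex lattice polygon with lattice points `K`. -/
def trianglesIn (K : Set (ℤ × ℤ)) : Set UnitTriangle :=
  {t | ∀ P ∈ t.vertices, P ∈ K}

/-- A lattice hexagon, given by the six lattice lines that carry its sides: the northern and
southern sides lie on `j = n` and `j = s`, the northwestern and southeastern ones on `i = nw` and
`i = se`, the southwestern and northeastern ones on `i + j = sw` and `i + j = ne`. -/
@[ext] structure Hexagon where
  (n s nw se sw ne : ℤ)

namespace Hexagon

/-- Lattice points of the closed hexagon. -/
def points (H : Hexagon) : Set (ℤ × ℤ) :=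
  {Q | H.s ≤ Q.2 ∧ Q.2 ≤ H.n ∧ H.nw ≤ Q.1 ∧ Q.1 ≤ H.se ∧
    H.sw ≤ Q.1 + Q.2 ∧ Q.1 + Q.2 ≤ H.ne}

/-- `H.HasSides l₁ l₂ l₃ l₄ l₅ l₆`: the sides of `H` have these lengths, in clockwise order from
the northern one. The vertices of `H`, in clockwise order from the left end of the northern side,
are `(nw, n)`, `(ne - n, n)`, `(se, ne - se)`, `(se, s)`, `(sw - s, s)`, `(nw, sw - nw)`. -/
def HasSides (H : Hexagon) (l₁ l₂ l₃ l₄ l₅ l₆ : ℕ) : Prop :=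
  (H.ne - H.n) - H.nw = l₁ ∧
  H.se - (H.ne - H.n) = l₂ ∧
  (H.ne - H.se) - H.s = l₃ ∧
  H.se - (H.sw - H.s) = l₄ ∧
  (H.sw - H.s) - H.nw = l₅ ∧
  H.n - (H.sw - H.nw) = l₆

end Hexagon

/-- The data of a hexagon and of three bowties: the nodes `A` (top), `B` (left), `C` (right), and
the types `(a, a')`, `(b, b')`, `(c, c')` of the bowties at these nodes, where `a, b, c` are the
sides of the down-pointing lobes and `a', b', c'` the sides of the up-pointing lobes. -/
@[ext] structure Config where
  (hex : Hexagon)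
  (A B C : ℤ × ℤ)
  (a b c a' b' c' : ℕ)

namespace Config

/-- The lobes of the three bowties (as sets of lattice points). The up-pointing (inner) lobes lie
at the three angles of the up-pointing triangle `ABC`: `A` is the top vertex of its inner lobe,
`B` the bottom left vertex, `C` the bottom right vertex. The down-pointing (outer) lobes are
opposite to them: `A` is the bottom vertex of its outer lobe, `B` the top right vertex,
`C` the top left vertex. -/
def outerA (R : Config) : Set (ℤ × ℤ) := downPoints R.A R.a
def outerB (R : Config) : Set (ℤ × ℤ) := downPoints (R.B.1, R.B.2 - R.b) R.b
def outerC (R : Config) : Set (ℤ × ℤ) := downPoints (R.C.1 + R.c, R.C.2 - R.c) R.c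
def innerA (R : Config) : Set (ℤ × ℤ) := upPoints (R.A.1, R.A.2 - R.a') R.a'
def innerB (R : Config) : Set (ℤ × ℤ) := upPoints R.B R.b'
def innerC (R : Config) : Set (ℤ × ℤ) := upPoints (R.C.1 - R.c', R.C.2) R.c'

/-- The six lobes. -/
def lobes (R : Config) : Set (Set (ℤ × ℤ)) :=
  {R.outerA, R.outerB, R.outerC, R.innerA, R.innerB, R.innerC}

/-- The configuration describes a triad hexagon:
* the nodes `A`, `B`, `C` (top, left, right) form an up-pointing lattice triangle, whose side is
  the focal distance `f`, and `f ≥ a' + b' + c'`;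
* the hexagon has sides `x+a+b+c`, `y+a'+b'+c'`, `z+a+b+c`, `x+a'+b'+c'`, `y+a+b+c`,
  `z+a'+b'+c'` (clockwise from top) with nonnegative integers `x`, `y`, `z`;
* the bowties are contained in the hexagon. -/
def IsTriadHexagon (R : Config) : Prop :=
  (∃ f : ℕ, R.A = (R.B.1, R.B.2 + f) ∧ R.C = (R.B.1 + f, R.B.2) ∧ R.a' + R.b' + R.c' ≤ f) ∧
  (∃ x y z : ℕ, R.hex.HasSides
    (x + R.a + R.b + R.c) (y + R.a' + R.b' + R.c') (z + R.a + R.b + R.c)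
    (x + R.a' + R.b' + R.c') (y + R.a + R.b + R.c) (z + R.a' + R.b' + R.c')) ∧
  ∀ K ∈ R.lobes, K ⊆ R.hex.points

/-- The region of the configuration: the unit triangles of the hexagon that lie in none of the
removed lobes. -/
def region (R : Config) : Set UnitTriangle :=
  trianglesIn R.hex.points \ ⋃ K ∈ R.lobes, trianglesIn K

/-- The region admits at least one lozenge tiling. -/
def Tileable (R : Config) : Prop := ∃ T, IsLozengeTiling R.region T

/-- `δ(BC, S) - b - c`, with `δ(BC, S)` the distance, in lattice spacings, from the line `BC`
(`j = B.2`) to the southern side. The focal edges of a triad hexagon lie inside the hexagon, so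
this difference of coordinates and the next two are the distances. -/
def depthS (R : Config) : ℤ := (R.B.2 - R.hex.s) - R.b - R.c

/-- `δ(AC, NE) - a - c`; the line `AC` is `i + j = A.1 + A.2`. -/
def depthNE (R : Config) : ℤ := (R.hex.ne - (R.A.1 + R.A.2)) - R.a - R.c

/-- `δ(AB, NW) - a - b`; the line `AB` is `i = A.1`. -/
def depthNW (R : Config) : ℤ := (R.A.1 - R.hex.nw) - R.a - R.b

/-- `Q` is obtained from `R` by squeezing out the top bowtie `d` units: `A` is fixed, `B` and `C`
move `d` units in the directions of the vectors `BA` and `CA`, the northwestern, northern and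
northeastern sides are pushed out `d` units, and the other three are pulled in `d` units. -/
def SqueezeOutTop (d : ℕ) (R Q : Config) : Prop :=
  d ≤ R.a' ∧ Q =
    { hex :=
        { n := R.hex.n + d, s := R.hex.s + d, nw := R.hex.nw - d,
          se := R.hex.se - d, sw := R.hex.sw + d, ne := R.hex.ne + d }
      A := R.A
      B := (R.B.1, R.B.2 + d)
      C := (R.C.1 - d, R.C.2 + d)
      a := R.a + d, b := R.b, c := R.c
      a' := R.a' - d, b' := R.b', c' := R.c' }

/-- `Q` is obtained from `R` by squeezing out the left bowtie `d` units: `B` is fixed, `A` and `C`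
move `d` units in the directions of the vectors `AB` and `CB`, the northwestern, southwestern and
southern sides are pushed out `d` units, and the other three are pulled in `d` units. -/
def SqueezeOutLeft (d : ℕ) (R Q : Config) : Prop :=
  d ≤ R.b' ∧ Q =
    { hex :=
        { n := R.hex.n - d, s := R.hex.s - d, nw := R.hex.nw - d,
          se := R.hex.se - d, sw := R.hex.sw - d, ne := R.hex.ne - d }
      A := (R.A.1, R.A.2 - d)
      B := R.B
      C := (R.C.1 - d, R.C.2)
      a := R.a, b := R.b + d, c := R.c
      a' := R.a', b' := R.b' - d, c' := R.c' }

/-- `Q` is obtained from `R` by squeezing out the right bowtie `d` units: `C` is fixed, `A` and `B`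
move `d` units in the directions of the vectors `AC` and `BC`, the northeastern, southeastern and
southern sides are pushed out `d` units, and the other three are pulled in `d` units. -/
def SqueezeOutRight (d : ℕ) (R Q : Config) : Prop :=
  d ≤ R.c' ∧ Q =
    { hex :=
        { n := R.hex.n - d, s := R.hex.s - d, nw := R.hex.nw + d,
          se := R.hex.se + d, sw := R.hex.sw + d, ne := R.hex.ne + d }
      A := (R.A.1 + d, R.A.2 - d)
      B := (R.B.1 + d, R.B.2)
      C := R.C
      a := R.a, b := R.b, c := R.c + d
      a' := R.a', b' := R.b', c' := R.c' - d }

/-- `Q` is obtained from `R` by squeezing out one of the three bowties. -/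
def SqueezeOut (R Q : Config) : Prop :=
  ∃ d : ℕ, SqueezeOutTop d R Q ∨ SqueezeOutLeft d R Q ∨ SqueezeOutRight d R Q

/-- `Q` is obtained from `R` by one bowtie squeezing: squeezing out, or its inverse operation,
squeezing in. (Squeezing in the `(a, a')`-bowtie `d` units turns `a` into `a - d`, so it is
possible exactly for `d ≤ a`.) -/
def Squeeze (R Q : Config) : Prop := SqueezeOut R Q ∨ SqueezeOut Q R

end Config

end TriadHexagon

/-!
In the coordinates `i`, `j`, `i + j`, a triad hexagon is determined by its node `B`, the six sides
of its lobes, its three depths `p` (NE), `q` (NW), `r` (S), and the distances `α`, `β`, `γ` of the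
outer lobes at `A`, `B`, `C` from the sides `N`, `SW`, `SE` facing them. In these terms
`x = p + q - α`, `y = q + r - β`, `z = p + r - γ` and
`f = a' + b' + c' + p + q + r - α - β - γ`. Being a triad hexagon with nonnegative depths
means that the six slacks are nonnegative and that `x`, `y`, `z` and `f - a' - b' - c'` are
(`IsSlack`). Squeezing changes none of these, which gives the invariance of the depths, and the
last part of the theorem once tileability is known to be nonnegativity of the depths.

Necessity is a violation of Hall's condition: if `δ(BC, S) < b + c`, the up-pointing triangles
below `BC` and between the outer lobes at `B` and `C` have too few down-pointing neighbours
(`IsTriadHexagon.depthS_nonneg`); rotation by 120° gives the other two depths.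

For sufficiency a tiling is constructed. If one of `α`, `β`, `γ` is positive, a side that faces an
outer lobe can be pulled in by one unit together with one of the sides next to it; what is cut off
consists of two parallelograms, and the smaller region is tileable by induction
(`IsSlack.tileable_of_pull`). If `α = β = γ = 0`, the region is cut into 15 hexagons with equal
opposite sides, some of them degenerate to parallelograms, and each of these can be tiled
(`isTileable_symHex`). Three of them form a core inside the triangle `ABC`
(`isTileable_focalCore`), and there are four on each side of the triangle (`isTileable_wing`), one
of which is a rhombus that straddles the side and corrects the excess of down-pointing triangles
outside it (`IsSlack.tileable_of_touching`).
-/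

namespace TriadHexagon

/-! ### Tileable sets of unit triangles -/

/-- The set `S` of unit triangles admits a lozenge tiling. -/
def IsTileable (S : Set UnitTriangle) : Prop := ∃ T, IsLozengeTiling S T

/-- Two unit triangles share an edge. -/
def UnitTriangle.Adj (s t : UnitTriangle) : Prop := (s.vertices ∩ t.vertices).card = 2

theorem UnitTriangle.Adj.symm {s t : UnitTriangle} (h : s.Adj t) : t.Adj s := by
  unfold UnitTriangle.Adj at *
  rwa [Finset.inter_comm]

theorem adj_up_down_same (i j : ℤ) : (UnitTriangle.up i j).Adj (.down i j) := by
  have h : (UnitTriangle.up i j).vertices ∩ (UnitTriangle.down i j).vertices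
      = {(i + 1, j), (i, j + 1)} := by
    ext ⟨x, y⟩
    simp only [UnitTriangle.vertices, Finset.mem_inter, Finset.mem_insert, Finset.mem_singleton,
      Prod.mk.injEq]
    omega
  rw [UnitTriangle.Adj, h, Finset.card_pair (by simp)]

theorem adj_up_down_left (i j : ℤ) : (UnitTriangle.up i j).Adj (.down (i - 1) j) := by
  have h : (UnitTriangle.up i j).vertices ∩ (UnitTriangle.down (i - 1) j).vertices
      = {(i, j), (i, j + 1)} := by
    ext ⟨x, y⟩
    simp only [UnitTriangle.vertices, Finset.mem_inter, Finset.mem_insert, Finset.mem_singleton,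
      Prod.mk.injEq]
    omega
  rw [UnitTriangle.Adj, h, Finset.card_pair (by simp)]

theorem adj_up_down_below (i j : ℤ) : (UnitTriangle.up i j).Adj (.down i (j - 1)) := by
  have h : (UnitTriangle.up i j).vertices ∩ (UnitTriangle.down i (j - 1)).vertices
      = {(i, j), (i + 1, j)} := by
    ext ⟨x, y⟩
    simp only [UnitTriangle.vertices, Finset.mem_inter, Finset.mem_insert, Finset.mem_singleton,
      Prod.mk.injEq]
    omega
  rw [UnitTriangle.Adj, h, Finset.card_pair (by simp)]

theorem UnitTriangle.Adj.eq_down {i j : ℤ} {t : UnitTriangle} (h : (UnitTriangle.up i j).Adj t) :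
    t = .down i j ∨ t = .down (i - 1) j ∨ t = .down i (j - 1) := by
  obtain ⟨⟨x₁, x₂⟩, hx, ⟨y₁, y₂⟩, hy, hxy⟩ := Finset.one_lt_card.1
    (show 1 < ((UnitTriangle.up i j).vertices ∩ t.vertices).card by
      rw [show _ = 2 from h]; norm_num)
  cases t with
  | up k l =>
    simp only [UnitTriangle.vertices, Finset.mem_inter, Finset.mem_insert, Finset.mem_singleton,
      Prod.mk.injEq, ne_eq] at hx hy hxy
    -- two distinct up-pointing unit triangles share at most one vertex
    obtain ⟨rfl, rfl⟩ : i = k ∧ j = l := by omega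
    have h3 : (UnitTriangle.up i j).vertices.card = 3 := by
      rw [show (UnitTriangle.up i j).vertices = {(i, j), (i + 1, j), (i, j + 1)} from rfl,
        Finset.card_insert_of_notMem (by simp), Finset.card_pair (by simp)]
    rw [UnitTriangle.Adj, Finset.inter_self] at h
    omega
  | down k l =>
    simp only [UnitTriangle.vertices, Finset.mem_inter, Finset.mem_insert, Finset.mem_singleton,
      Prod.mk.injEq, ne_eq] at hx hy hxy
    simp only [UnitTriangle.down.injEq]
    omega

/-- An involution of `S` that moves every triangle to an adjacent one gives a lozenge tiling. -/
theorem IsTileable.of_matching {S : Set UnitTriangle} (m : UnitTriangle → UnitTriangle)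
    (hm : ∀ t ∈ S, m t ∈ S) (hmm : ∀ t ∈ S, m (m t) = t) (hadj : ∀ t ∈ S, t.Adj (m t)) :
    IsTileable S := by
  refine ⟨{L | ∃ t ∈ S, L = {t, m t}}, ?_, ?_⟩
  · rintro _ ⟨t, ht, rfl⟩
    refine ⟨⟨t, m t, hadj t ht, rfl⟩, ?_⟩
    rintro u (rfl | rfl)
    exacts [ht, hm t ht]
  · intro t ht
    refine ⟨{t, m t}, ⟨⟨t, ht, rfl⟩, Or.inl rfl⟩, ?_⟩
    rintro _ ⟨⟨s, hs, rfl⟩, rfl | rfl⟩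
    · rfl
    · rw [hmm s hs, Set.pair_comm]

/-- A set of unit triangles is tileable by lozenges of a single kind if it contains with each
triangle its neighbour in the direction belonging to that kind. -/
theorem IsTileable.of_shift {S : Set UnitTriangle} (di dj : ℤ)
    (hadj : ∀ i j, (UnitTriangle.up i j).Adj (.down (i + di) (j + dj)))
    (hS : ∀ i j, UnitTriangle.up i j ∈ S ↔ UnitTriangle.down (i + di) (j + dj) ∈ S) :
    IsTileable S := by
  have key : ∀ i j, UnitTriangle.down i j ∈ S ↔ UnitTriangle.up (i - di) (j - dj) ∈ S := by
    intro i j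
    rw [hS]; simp
  refine .of_matching (fun t => match t with
    | .up i j => .down (i + di) (j + dj)
    | .down i j => .up (i - di) (j - dj)) ?_ ?_ ?_
  · rintro (⟨i, j⟩ | ⟨i, j⟩) ht
    · exact (hS i j).1 ht
    · exact (key i j).1 ht
  · rintro (⟨i, j⟩ | ⟨i, j⟩) ht <;> simp
  · rintro (⟨i, j⟩ | ⟨i, j⟩) ht
    · exact hadj i j
    · have := hadj (i - di) (j - dj)
      simp only [sub_add_cancel] at this
      exact this.symm

theorem IsTileable.union {S₁ S₂ : Set UnitTriangle} (h₁ : IsTileable S₁) (h₂ : IsTileable S₂)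
    (hd : ∀ t ∈ S₁, t ∉ S₂) : IsTileable (S₁ ∪ S₂) := by
  obtain ⟨T₁, hT₁, hu₁⟩ := h₁
  obtain ⟨T₂, hT₂, hu₂⟩ := h₂
  refine ⟨T₁ ∪ T₂, ?_, ?_⟩
  · rintro L (hL | hL)
    · exact ⟨(hT₁ L hL).1, (hT₁ L hL).2.trans Set.subset_union_left⟩
    · exact ⟨(hT₂ L hL).1, (hT₂ L hL).2.trans Set.subset_union_right⟩
  · rintro t (ht | ht)
    · obtain ⟨L, ⟨hL, htL⟩, huL⟩ := hu₁ t ht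
      refine ⟨L, ⟨Or.inl hL, htL⟩, ?_⟩
      rintro M ⟨hM | hM, htM⟩
      · exact huL M ⟨hM, htM⟩
      · exact absurd ((hT₂ M hM).2 htM) (hd t ht)
    · obtain ⟨L, ⟨hL, htL⟩, huL⟩ := hu₂ t ht
      refine ⟨L, ⟨Or.inr hL, htL⟩, ?_⟩
      rintro M ⟨hM | hM, htM⟩
      · exact absurd ht (hd t ((hT₁ M hM).2 htM))
      · exact huL M ⟨hM, htM⟩

/-- A set of unit triangles that is partitioned into two tileable sets is tileable; stated
separately for the up-pointing and for the down-pointing triangles. -/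
theorem IsTileable.of_partition {S S₁ S₂ : Set UnitTriangle} (h₁ : IsTileable S₁)
    (h₂ : IsTileable S₂)
    (hu : ∀ i j, (UnitTriangle.up i j ∈ S ↔ UnitTriangle.up i j ∈ S₁ ∨ UnitTriangle.up i j ∈ S₂) ∧
      ¬ (UnitTriangle.up i j ∈ S₁ ∧ UnitTriangle.up i j ∈ S₂))
    (hd : ∀ i j, (UnitTriangle.down i j ∈ S ↔
      UnitTriangle.down i j ∈ S₁ ∨ UnitTriangle.down i j ∈ S₂) ∧
      ¬ (UnitTriangle.down i j ∈ S₁ ∧ UnitTriangle.down i j ∈ S₂)) :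
    IsTileable S := by
  have hS : S = S₁ ∪ S₂ := by
    ext (⟨i, j⟩ | ⟨i, j⟩)
    · exact (hu i j).1
    · exact (hd i j).1
  rw [hS]
  refine h₁.union h₂ ?_
  rintro (⟨i, j⟩ | ⟨i, j⟩) h h'
  · exact (hu i j).2 ⟨h, h'⟩
  · exact (hd i j).2 ⟨h, h'⟩

/-! ### Rotation by 120° -/

/-- The counterclockwise rotation of the lattice by 120° about the origin. -/
def rotPoint (P : ℤ × ℤ) : ℤ × ℤ := (-P.1 - P.2, P.1)

/-- The counterclockwise rotation by 120° about the origin, on unit triangles. -/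
def UnitTriangle.rot : UnitTriangle → UnitTriangle
  | .up i j => .up (-i - j - 1) i
  | .down i j => .down (-i - j - 2) i

theorem rotPoint_injective : Function.Injective rotPoint := by
  rintro ⟨x, y⟩ ⟨x', y'⟩ h
  simp only [rotPoint, Prod.mk.injEq] at h ⊢
  omega

theorem UnitTriangle.vertices_rot (t : UnitTriangle) :
    t.rot.vertices = t.vertices.image rotPoint := by
  cases t with
  | up i j =>
    ext ⟨x, y⟩
    simp [UnitTriangle.vertices, UnitTriangle.rot, rotPoint]
    omega
  | down i j =>
    ext ⟨x, y⟩
    simp [UnitTriangle.vertices, UnitTriangle.rot, rotPoint]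
    omega

theorem UnitTriangle.adj_rot {s t : UnitTriangle} : s.rot.Adj t.rot ↔ s.Adj t := by
  rw [UnitTriangle.Adj, UnitTriangle.vertices_rot, UnitTriangle.vertices_rot,
    ← Finset.image_inter _ _ rotPoint_injective,
    Finset.card_image_of_injective _ rotPoint_injective, UnitTriangle.Adj]

theorem UnitTriangle.rot_bijective : Function.Bijective UnitTriangle.rot := by
  refine ⟨?_, ?_⟩
  · rintro (⟨i, j⟩ | ⟨i, j⟩) (⟨k, l⟩ | ⟨k, l⟩) h <;>
    simp only [UnitTriangle.rot, UnitTriangle.up.injEq, UnitTriangle.down.injEq,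
      reduceCtorEq] at h ⊢ <;> omega
  · rintro (⟨i, j⟩ | ⟨i, j⟩)
    · exact ⟨.up j (-i - j - 1), by
        simp only [UnitTriangle.rot, UnitTriangle.up.injEq, and_true]; omega⟩
    · exact ⟨.down j (-i - j - 2), by
        simp only [UnitTriangle.rot, UnitTriangle.down.injEq, and_true]; omega⟩

theorem IsTileable.preimage_rot {S : Set UnitTriangle} (h : IsTileable S) :
    IsTileable (UnitTriangle.rot ⁻¹' S) := by
  obtain ⟨T, hT, hu⟩ := h
  have hinj := UnitTriangle.rot_bijective.1
  have hsurj := UnitTriangle.rot_bijective.2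
  refine ⟨{L | UnitTriangle.rot '' L ∈ T}, ?_, ?_⟩
  · intro L hL
    obtain ⟨⟨s, t, hst, hLst⟩, hLS⟩ := hT _ hL
    obtain ⟨s, rfl⟩ := hsurj s
    obtain ⟨t, rfl⟩ := hsurj t
    refine ⟨⟨s, t, UnitTriangle.adj_rot.1 hst, ?_⟩, Set.image_subset_iff.1 hLS⟩
    rw [← Set.image_pair] at hLst
    exact hinj.image_injective hLst
  · intro t ht
    obtain ⟨L, ⟨hL, htL⟩, huL⟩ := hu _ ht
    obtain ⟨L, rfl⟩ := hsurj.image_surjective L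
    refine ⟨L, ⟨hL, (hinj.mem_set_image).1 htL⟩, ?_⟩
    rintro M ⟨hM, htM⟩
    exact hinj.image_injective (huL _ ⟨hM, Set.mem_image_of_mem _ htM⟩)

/-! ### Hexagons with equal opposite sides -/

theorem up_mem_trianglesIn_hexagon {H : Hexagon} {i j : ℤ} :
    UnitTriangle.up i j ∈ trianglesIn H.points ↔
      H.nw ≤ i ∧ i + 1 ≤ H.se ∧ H.s ≤ j ∧ j + 1 ≤ H.n ∧ H.sw ≤ i + j ∧ i + j + 1 ≤ H.ne := by
  simp only [trianglesIn, UnitTriangle.vertices, Hexagon.points, Set.mem_ofPred_eq,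
    Finset.mem_insert, Finset.mem_singleton, forall_eq_or_imp, forall_eq]
  omega

theorem down_mem_trianglesIn_hexagon {H : Hexagon} {i j : ℤ} :
    UnitTriangle.down i j ∈ trianglesIn H.points ↔
      H.nw ≤ i ∧ i + 1 ≤ H.se ∧ H.s ≤ j ∧ j + 1 ≤ H.n ∧ H.sw ≤ i + j + 1 ∧
        i + j + 2 ≤ H.ne := by
  simp only [trianglesIn, UnitTriangle.vertices, Hexagon.points, Set.mem_ofPred_eq,
    Finset.mem_insert, Finset.mem_singleton, forall_eq_or_imp, forall_eq]
  omega

theorem up_mem_trianglesIn_downPoints {P : ℤ × ℤ} {n : ℕ} {i j : ℤ} :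
    UnitTriangle.up i j ∈ trianglesIn (downPoints P n) ↔
      i + 1 ≤ P.1 ∧ j + 1 ≤ P.2 + n ∧ P.1 + P.2 ≤ i + j := by
  simp only [trianglesIn, UnitTriangle.vertices, downPoints, Set.mem_ofPred_eq,
    Finset.mem_insert, Finset.mem_singleton, forall_eq_or_imp, forall_eq]
  omega

theorem down_mem_trianglesIn_downPoints {P : ℤ × ℤ} {n : ℕ} {i j : ℤ} :
    UnitTriangle.down i j ∈ trianglesIn (downPoints P n) ↔
      i + 1 ≤ P.1 ∧ j + 1 ≤ P.2 + n ∧ P.1 + P.2 ≤ i + j + 1 := by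
  simp only [trianglesIn, UnitTriangle.vertices, downPoints, Set.mem_ofPred_eq,
    Finset.mem_insert, Finset.mem_singleton, forall_eq_or_imp, forall_eq]
  omega

theorem up_mem_trianglesIn_upPoints {P : ℤ × ℤ} {n : ℕ} {i j : ℤ} :
    UnitTriangle.up i j ∈ trianglesIn (upPoints P n) ↔
      P.1 ≤ i ∧ P.2 ≤ j ∧ i + j + 1 ≤ P.1 + P.2 + n := by
  simp only [trianglesIn, UnitTriangle.vertices, upPoints, Set.mem_ofPred_eq,
    Finset.mem_insert, Finset.mem_singleton, forall_eq_or_imp, forall_eq]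
  omega

theorem down_mem_trianglesIn_upPoints {P : ℤ × ℤ} {n : ℕ} {i j : ℤ} :
    UnitTriangle.down i j ∈ trianglesIn (upPoints P n) ↔
      P.1 ≤ i ∧ P.2 ≤ j ∧ i + j + 2 ≤ P.1 + P.2 + n := by
  simp only [trianglesIn, UnitTriangle.vertices, upPoints, Set.mem_ofPred_eq,
    Finset.mem_insert, Finset.mem_singleton, forall_eq_or_imp, forall_eq]
  omega

/-- The hexagon whose sides have lengths `u` (northern and southern), `v` (northeastern and
southwestern), `w` (northwestern and southeastern), with western vertex `(i, j + v)` and southern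
side on the line of height `j`. If one of the lengths is `0`, this is a parallelogram. -/
def symHexagon (i j : ℤ) (u v w : ℕ) : Hexagon where
  n := j + v + w
  s := j
  nw := i
  se := i + u + v
  sw := i + j + v
  ne := i + j + u + v + w

/-- The unit triangles of `symHexagon i j u v w`. -/
def symHex (i j : ℤ) (u v w : ℕ) : Set UnitTriangle := trianglesIn (symHexagon i j u v w).points

theorem up_mem_symHex {x y i j : ℤ} {u v w : ℕ} : UnitTriangle.up i j ∈ symHex x y u v w ↔
    x ≤ i ∧ i + 1 ≤ x + u + v ∧ y ≤ j ∧ j + 1 ≤ y + v + w ∧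
      x + y + v ≤ i + j ∧ i + j + 1 ≤ x + y + u + v + w :=
  up_mem_trianglesIn_hexagon

theorem down_mem_symHex {x y i j : ℤ} {u v w : ℕ} : UnitTriangle.down i j ∈ symHex x y u v w ↔
    x ≤ i ∧ i + 1 ≤ x + u + v ∧ y ≤ j ∧ j + 1 ≤ y + v + w ∧
      x + y + v ≤ i + j + 1 ∧ i + j + 2 ≤ x + y + u + v + w :=
  down_mem_trianglesIn_hexagon

/-- Three parallelograms, one for each kind of lozenge, fill the hexagon: they meet in the lattice
point `(i + u, j + v)`. -/
theorem isTileable_symHex (i j : ℤ) (u v w : ℕ) : IsTileable (symHex i j u v w) := by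
  have h₁ : IsTileable (symHex i (j + v) u 0 w) := by
    refine .of_shift 0 0 (fun k l => by simpa using adj_up_down_same k l) fun k l => ?_
    rw [up_mem_symHex, down_mem_symHex]
    omega
  have h₂ : IsTileable (symHex i j u v 0) := by
    refine .of_shift (-1) 0 (fun k l => by
      simpa [sub_eq_add_neg] using adj_up_down_left k l) fun k l => ?_
    rw [up_mem_symHex, down_mem_symHex]
    omega
  have h₃ : IsTileable (symHex (i + u) j 0 v w) := by
    refine .of_shift 0 (-1) (fun k l => by
      simpa [sub_eq_add_neg] using adj_up_down_below k l) fun k l => ?_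
    rw [up_mem_symHex, down_mem_symHex]
    omega
  have h₂₃ : IsTileable (symHex i j u v 0 ∪ symHex (i + u) j 0 v w) := by
    refine .of_partition h₂ h₃ (fun k l => ⟨Iff.rfl, ?_⟩) fun k l => ⟨Iff.rfl, ?_⟩
    · rw [up_mem_symHex, up_mem_symHex]
      omega
    · rw [down_mem_symHex, down_mem_symHex]
      omega
  refine .of_partition h₁ h₂₃ (fun k l => ?_) fun k l => ?_
  · simp only [Set.mem_union, up_mem_symHex]
    omega
  · simp only [Set.mem_union, down_mem_symHex]
    omega

namespace Config

/-! ### Triad hexagons in coordinates -/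

theorem up_mem_region {R : Config} {i j : ℤ} : UnitTriangle.up i j ∈ R.region ↔
    (R.hex.nw ≤ i ∧ i + 1 ≤ R.hex.se ∧ R.hex.s ≤ j ∧ j + 1 ≤ R.hex.n ∧
      R.hex.sw ≤ i + j ∧ i + j + 1 ≤ R.hex.ne) ∧
    ¬ (i + 1 ≤ R.A.1 ∧ j + 1 ≤ R.A.2 + R.a ∧ R.A.1 + R.A.2 ≤ i + j) ∧
    ¬ (i + 1 ≤ R.B.1 ∧ j + 1 ≤ R.B.2 ∧ R.B.1 + R.B.2 - R.b ≤ i + j) ∧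
    ¬ (i + 1 ≤ R.C.1 + R.c ∧ j + 1 ≤ R.C.2 ∧ R.C.1 + R.C.2 ≤ i + j) ∧
    ¬ (R.A.1 ≤ i ∧ R.A.2 - R.a' ≤ j ∧ i + j + 1 ≤ R.A.1 + R.A.2) ∧
    ¬ (R.B.1 ≤ i ∧ R.B.2 ≤ j ∧ i + j + 1 ≤ R.B.1 + R.B.2 + R.b') ∧
    ¬ (R.C.1 - R.c' ≤ i ∧ R.C.2 ≤ j ∧ i + j + 1 ≤ R.C.1 + R.C.2) := by
  simp only [region, lobes, outerA, outerB, outerC, innerA, innerB, innerC, Set.mem_sdiff,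
    Set.mem_iUnion, Set.mem_insert_iff, Set.mem_singleton_iff, exists_prop, exists_eq_or_imp,
    exists_eq_left, up_mem_trianglesIn_hexagon, up_mem_trianglesIn_downPoints,
    up_mem_trianglesIn_upPoints, not_or]
  refine and_congr Iff.rfl (and_congr ?_ (and_congr ?_ (and_congr ?_ (and_congr ?_
    (and_congr ?_ ?_))))) <;> omega

theorem down_mem_region {R : Config} {i j : ℤ} : UnitTriangle.down i j ∈ R.region ↔
    (R.hex.nw ≤ i ∧ i + 1 ≤ R.hex.se ∧ R.hex.s ≤ j ∧ j + 1 ≤ R.hex.n ∧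
      R.hex.sw ≤ i + j + 1 ∧ i + j + 2 ≤ R.hex.ne) ∧
    ¬ (i + 1 ≤ R.A.1 ∧ j + 1 ≤ R.A.2 + R.a ∧ R.A.1 + R.A.2 ≤ i + j + 1) ∧
    ¬ (i + 1 ≤ R.B.1 ∧ j + 1 ≤ R.B.2 ∧ R.B.1 + R.B.2 - R.b ≤ i + j + 1) ∧
    ¬ (i + 1 ≤ R.C.1 + R.c ∧ j + 1 ≤ R.C.2 ∧ R.C.1 + R.C.2 ≤ i + j + 1) ∧
    ¬ (R.A.1 ≤ i ∧ R.A.2 - R.a' ≤ j ∧ i + j + 2 ≤ R.A.1 + R.A.2) ∧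
    ¬ (R.B.1 ≤ i ∧ R.B.2 ≤ j ∧ i + j + 2 ≤ R.B.1 + R.B.2 + R.b') ∧
    ¬ (R.C.1 - R.c' ≤ i ∧ R.C.2 ≤ j ∧ i + j + 2 ≤ R.C.1 + R.C.2) := by
  simp only [region, lobes, outerA, outerB, outerC, innerA, innerB, innerC, Set.mem_sdiff,
    Set.mem_iUnion, Set.mem_insert_iff, Set.mem_singleton_iff, exists_prop, exists_eq_or_imp,
    exists_eq_left, down_mem_trianglesIn_hexagon, down_mem_trianglesIn_downPoints,
    down_mem_trianglesIn_upPoints, not_or]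
  refine and_congr Iff.rfl (and_congr ?_ (and_congr ?_ (and_congr ?_ (and_congr ?_
    (and_congr ?_ ?_))))) <;> omega

theorem upPoints_subset_hexagon {P : ℤ × ℤ} {m : ℕ} {H : Hexagon} :
    upPoints P m ⊆ H.points ↔
      H.s ≤ P.2 ∧ P.2 + m ≤ H.n ∧ H.nw ≤ P.1 ∧ P.1 + m ≤ H.se ∧
        H.sw ≤ P.1 + P.2 ∧ P.1 + P.2 + m ≤ H.ne := by
  constructor
  · intro h
    have h₁ := @h (P.1, P.2) (by simp only [upPoints, Set.mem_ofPred_eq]; omega)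
    have h₂ := @h (P.1 + m, P.2) (by simp only [upPoints, Set.mem_ofPred_eq]; omega)
    have h₃ := @h (P.1, P.2 + m) (by simp only [upPoints, Set.mem_ofPred_eq]; omega)
    simp only [Hexagon.points, Set.mem_ofPred_eq] at h₁ h₂ h₃
    omega
  · rintro h ⟨x, y⟩ hQ
    simp only [upPoints, Hexagon.points, Set.mem_ofPred_eq] at hQ ⊢
    omega

theorem downPoints_subset_hexagon {P : ℤ × ℤ} {m : ℕ} {H : Hexagon} :
    downPoints P m ⊆ H.points ↔
      H.s ≤ P.2 ∧ P.2 + m ≤ H.n ∧ H.nw ≤ P.1 - m ∧ P.1 ≤ H.se ∧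
        H.sw ≤ P.1 + P.2 ∧ P.1 + P.2 + m ≤ H.ne := by
  constructor
  · intro h
    have h₁ := @h (P.1, P.2) (by simp only [downPoints, Set.mem_ofPred_eq]; omega)
    have h₂ := @h (P.1 - m, P.2 + m) (by simp only [downPoints, Set.mem_ofPred_eq]; omega)
    have h₃ := @h (P.1, P.2 + m) (by simp only [downPoints, Set.mem_ofPred_eq]; omega)
    simp only [Hexagon.points, Set.mem_ofPred_eq] at h₁ h₂ h₃
    omega
  · rintro h ⟨x, y⟩ hQ
    simp only [downPoints, Hexagon.points, Set.mem_ofPred_eq] at hQ ⊢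
    omega

/-- The outer lobes lie in the hexagon. Only the inequalities are listed that imply the remaining
ones, also for the inner lobes, if the nodes form an up-pointing triangle with
`a' + b' + c' ≤ f`. -/
structure LobesFit (R : Config) : Prop where
  outerA_N : R.A.2 + R.a ≤ R.hex.n
  outerA_NW : R.hex.nw ≤ R.A.1 - R.a
  outerA_NE : R.A.1 + R.A.2 + R.a ≤ R.hex.ne
  outerB_SW : R.hex.sw ≤ R.B.1 + R.B.2 - R.b
  outerB_NW : R.hex.nw ≤ R.B.1 - R.b
  outerB_S : R.hex.s ≤ R.B.2 - R.b
  outerC_SE : R.C.1 + R.c ≤ R.hex.se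
  outerC_NE : R.C.1 + R.C.2 + R.c ≤ R.hex.ne
  outerC_S : R.hex.s ≤ R.C.2 - R.c

theorem lobes_subset_iff {R : Config} {f : ℕ} (hA : R.A = (R.B.1, R.B.2 + f))
    (hC : R.C = (R.B.1 + f, R.B.2)) (hf : R.a' + R.b' + R.c' ≤ f) :
    (∀ K ∈ R.lobes, K ⊆ R.hex.points) ↔ R.LobesFit := by
  simp only [Prod.ext_iff] at hA hC
  simp only [lobes, outerA, outerB, outerC, innerA, innerB, innerC, Set.mem_insert_iff,
    Set.mem_singleton_iff, forall_eq_or_imp, forall_eq, upPoints_subset_hexagon,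
    downPoints_subset_hexagon]
  constructor
  · rintro ⟨h₁, h₂, h₃, h₄, h₅, h₆⟩
    constructor <;> omega
  · rintro ⟨h₁, h₂, h₃, h₄, h₅, h₆, h₇, h₈, h₉⟩
    refine ⟨?_, ?_, ?_, ?_, ?_, ?_⟩ <;> omega

/-- A triad hexagon with focal distance `f` whose depths are `r` (southern), `p` (northeastern),
`q` (northwestern) and whose outer lobes have distances `α`, `β`, `γ` from the sides `N`, `SW`,
`SE` facing them. The sides of the hexagon are then determined; `x = p + q - α`,
`y = q + r - β`, `z = p + r - γ`, and `f = a' + b' + c' + p + q + r - α - β - γ`. The last four fields say that `x`, `y`, `z` and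
`f - a' - b' - c'` are nonnegative. -/
structure IsSlack (R : Config) (f p q r α β γ : ℕ) : Prop where
  A_fst : R.A.1 = R.B.1
  A_snd : R.A.2 = R.B.2 + f
  C_fst : R.C.1 = R.B.1 + f
  C_snd : R.C.2 = R.B.2
  north : R.hex.n = R.B.2 + f + R.a + α
  south : R.hex.s = R.B.2 - R.b - R.c - r
  northwest : R.hex.nw = R.B.1 - R.a - R.b - q
  southeast : R.hex.se = R.B.1 + f + R.c + γ
  southwest : R.hex.sw = R.B.1 + R.B.2 - R.b - β
  northeast : R.hex.ne = R.B.1 + R.B.2 + f + R.a + R.c + p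
  focal : f + α + β + γ = R.a' + R.b' + R.c' + p + q + r
  x_nonneg : α ≤ p + q
  y_nonneg : β ≤ q + r
  z_nonneg : γ ≤ p + r
  inner_le : α + β + γ ≤ p + q + r

theorem IsTriadHexagon.exists_isSlack {R : Config} (h : R.IsTriadHexagon) (hS : 0 ≤ R.depthS)
    (hNE : 0 ≤ R.depthNE) (hNW : 0 ≤ R.depthNW) :
    ∃ f p q r α β γ, R.IsSlack f p q r α β γ := by
  obtain ⟨⟨f, hA, hC, hf⟩, ⟨x, y, z, hs⟩, hl⟩ := h
  obtain ⟨h₁, h₂, h₃, h₄, h₅, h₆, h₇, h₈, h₉⟩ := (lobes_subset_iff hA hC hf).1 hl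
  simp only [Prod.ext_iff] at hA hC
  simp only [Hexagon.HasSides] at hs
  simp only [depthS, depthNE, depthNW] at hS hNE hNW
  obtain ⟨hA₁, hA₂⟩ := hA
  obtain ⟨hC₁, hC₂⟩ := hC
  obtain ⟨hs₁, hs₂, hs₃, hs₄, hs₅, hs₆⟩ := hs
  obtain ⟨p, hp⟩ := Int.eq_ofNat_of_zero_le hNE
  obtain ⟨q, hq⟩ := Int.eq_ofNat_of_zero_le hNW
  obtain ⟨r, hr⟩ := Int.eq_ofNat_of_zero_le hS
  obtain ⟨α, hα⟩ := Int.eq_ofNat_of_zero_le (sub_nonneg.2 h₁)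
  obtain ⟨β, hβ⟩ := Int.eq_ofNat_of_zero_le (sub_nonneg.2 h₄)
  obtain ⟨γ, hγ⟩ := Int.eq_ofNat_of_zero_le (sub_nonneg.2 h₇)
  clear h₁ h₂ h₃ h₄ h₅ h₆ h₇ h₈ h₉ hl hS hNE hNW
  have hx : (x : ℤ) = p + q - α := by omega
  have hy : (y : ℤ) = q + r - β := by omega
  have hz : (z : ℤ) = p + r - γ := by omega
  have hff : (f : ℤ) + α + β + γ = R.a' + R.b' + R.c' + p + q + r := by omega
  exact ⟨f, p, q, r, α, β, γ, hA₁, hA₂, hC₁, hC₂, by omega, by omega, by omega, by omega,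
    by omega, by omega, by omega, by omega, by omega, by omega, by omega⟩

/-! ### Rotated triad hexagons -/

/-- The image of the configuration under the counterclockwise rotation by 120°. The top, left and
right node become the left, right and top one. -/
def rot (R : Config) : Config where
  hex :=
    { n := R.hex.se, s := R.hex.nw, nw := -R.hex.ne, se := -R.hex.sw, sw := -R.hex.n,
      ne := -R.hex.s }
  A := rotPoint R.C
  B := rotPoint R.A
  C := rotPoint R.B
  a := R.c
  b := R.a
  c := R.b
  a' := R.c'
  b' := R.a'
  c' := R.b'

theorem region_rot (R : Config) (t : UnitTriangle) : t.rot ∈ R.rot.region ↔ t ∈ R.region := by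
  cases t with
  | up i j =>
    simp only [UnitTriangle.rot, up_mem_region, rot, rotPoint]
    constructor <;> rintro ⟨h₁, h₂, h₃, h₄, h₅, h₆, h₇⟩ <;>
      refine ⟨by omega, by omega, by omega, by omega, by omega, by omega, by omega⟩
  | down i j =>
    simp only [UnitTriangle.rot, down_mem_region, rot, rotPoint]
    constructor <;> rintro ⟨h₁, h₂, h₃, h₄, h₅, h₆, h₇⟩ <;>
      refine ⟨by omega, by omega, by omega, by omega, by omega, by omega, by omega⟩

theorem tileable_of_tileable_rot {R : Config} (h : R.rot.Tileable) : R.Tileable := by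
  have := IsTileable.preimage_rot h
  rwa [show UnitTriangle.rot ⁻¹' R.rot.region = R.region from Set.ext (region_rot R)] at this

theorem rot_rot_rot (R : Config) : R.rot.rot.rot = R := by
  ext <;> simp [rot, rotPoint] <;> omega

theorem Tileable.rot {R : Config} (h : R.Tileable) : R.rot.Tileable := by
  apply tileable_of_tileable_rot
  apply tileable_of_tileable_rot
  rwa [rot_rot_rot]

theorem IsTriadHexagon.rot {R : Config} (h : R.IsTriadHexagon) : R.rot.IsTriadHexagon := by
  obtain ⟨⟨f, hA, hC, hf⟩, ⟨x, y, z, hs⟩, hl⟩ := h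
  rw [lobes_subset_iff hA hC hf] at hl
  have hA' : R.rot.A = (R.rot.B.1, R.rot.B.2 + f) :=
    Prod.ext (by simp only [Config.rot, rotPoint, hA, hC]; omega)
      (by simp only [Config.rot, rotPoint, hA, hC])
  have hC' : R.rot.C = (R.rot.B.1 + f, R.rot.B.2) :=
    Prod.ext (by simp only [Config.rot, rotPoint, hA]; omega)
      (by simp only [Config.rot, rotPoint, hA])
  have hf' : R.rot.a' + R.rot.b' + R.rot.c' ≤ f := by
    simp only [Config.rot]; omega
  refine ⟨⟨f, hA', hC', hf'⟩, ⟨z, x, y, ?_⟩, ?_⟩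
  · simp only [Hexagon.HasSides, Config.rot] at hs ⊢
    omega
  · rw [lobes_subset_iff hA' hC' hf']
    obtain ⟨h₁, h₂, h₃, h₄, h₅, h₆, h₇, h₈, h₉⟩ := hl
    simp only [Prod.ext_iff] at hA hC
    constructor <;> simp only [Config.rot, rotPoint] <;> omega

theorem depthS_rot {R : Config} : R.rot.depthS = R.depthNW := by
  simp only [depthS, depthNW, rot, rotPoint]

theorem depthS_rot_rot {R : Config} (h : R.A.1 + R.A.2 = R.C.1 + R.C.2) :
    R.rot.rot.depthS = R.depthNE := by
  simp only [depthS, depthNE, rot, rotPoint]; omega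

end Config

/-! ### Necessity: too few down-pointing triangles -/

theorem IsTileable.exists_injOn {S : Set UnitTriangle} (h : IsTileable S) :
    ∃ m : UnitTriangle → UnitTriangle,
      (∀ t ∈ S, m t ∈ S ∧ t.Adj (m t)) ∧ Set.InjOn m S := by
  obtain ⟨T, hT, hu⟩ := h
  have key : ∀ t ∈ S, ∃ s ∈ S, t.Adj s ∧ {t, s} ∈ T := by
    intro t ht
    obtain ⟨L, ⟨hL, htL⟩, -⟩ := hu t ht
    obtain ⟨⟨s, s', hss', rfl⟩, hLS⟩ := hT L hL
    obtain rfl | rfl := htL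
    · exact ⟨s', hLS (Or.inr rfl), hss', hL⟩
    · exact ⟨s, hLS (Or.inl rfl), UnitTriangle.Adj.symm hss', by rwa [Set.pair_comm]⟩
  choose! m hm hadj hmT using key
  refine ⟨m, fun t ht => ⟨hm t ht, hadj t ht⟩, ?_⟩
  intro t ht t' ht' heq
  -- both lozenges contain `m t`, so they coincide
  have hL : ({t, m t} : Set UnitTriangle) = {t', m t} :=
    (hu _ (hm t ht)).unique ⟨hmT t ht, Or.inr rfl⟩ ⟨heq ▸ hmT t' ht', Or.inr rfl⟩
  have : t ∈ ({t', m t} : Set UnitTriangle) := hL ▸ Or.inl rfl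
  obtain h | h := this
  · exact h
  · have : t' ∈ ({t, m t} : Set UnitTriangle) := hL ▸ Or.inl rfl
    obtain h' | h' := this
    · exact h'.symm
    · exact h.trans h'.symm

/-- The counting condition of Hall's theorem, for up-pointing triangles that are arranged in rows;
`⟨j, i⟩` stands for `up i j` in `U` and for `down i j` in `D`. -/
theorem IsTileable.card_le {S : Set UnitTriangle} (h : IsTileable S)
    {U D : Finset (Σ _ : ℤ, ℤ)} (hU : ∀ i j, (⟨j, i⟩ : Σ _ : ℤ, ℤ) ∈ U → .up i j ∈ S)
    (hD : ∀ i j, (⟨j, i⟩ : Σ _ : ℤ, ℤ) ∈ U → ∀ k l, UnitTriangle.down k l ∈ S →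
      (k = i ∧ l = j ∨ k = i - 1 ∧ l = j ∨ k = i ∧ l = j - 1) → (⟨l, k⟩ : Σ _ : ℤ, ℤ) ∈ D) :
    U.card ≤ D.card := by
  obtain ⟨m, hm, hinj⟩ := h.exists_injOn
  have key : ∀ x ∈ U, ∃ y ∈ D, m (.up x.2 x.1) = .down y.2 y.1 := by
    rintro ⟨j, i⟩ hx
    obtain ⟨hmS, hadj⟩ := hm _ (hU i j hx)
    obtain h | h | h := hadj.eq_down <;> rw [h] at hmS <;>
      exact ⟨⟨_, _⟩, hD i j hx _ _ hmS (by omega), h⟩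
  choose! g hgD hg using key
  refine Finset.card_le_card_of_injOn g hgD ?_
  rintro ⟨j, i⟩ hx ⟨j', i'⟩ hx' heq
  have := hinj (hU i j hx) (hU i' j' hx') (by rw [hg _ hx, hg _ hx', heq])
  simp only [UnitTriangle.up.injEq] at this
  obtain ⟨rfl, rfl⟩ := this
  rfl

theorem card_rows {s e : ℤ} {L E : ℤ → ℤ} (h : ∀ j, s ≤ j → j < e → L j ≤ E j) :
    (((Finset.Ico s e).sigma fun j => Finset.Ico (L j) (E j)).card : ℤ)
      = ∑ j ∈ Finset.Ico s e, (E j - L j) := by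
  rw [Finset.card_sigma, Nat.cast_sum]
  refine Finset.sum_congr rfl fun j hj => ?_
  rw [Finset.mem_Ico] at hj
  have := h j hj.1 hj.2
  rw [Int.card_Ico]
  omega

theorem sum_ite_le {s t e : ℤ} (hs : s ≤ t) (he : t ≤ e) :
    ∑ j ∈ Finset.Ico s e, (if t ≤ j then (1 : ℤ) else 0) = e - t := by
  rw [Finset.sum_ite, Finset.sum_const_zero, add_zero, Finset.sum_const,
    show (Finset.Ico s e).filter (fun j => t ≤ j) = Finset.Ico t e by ext; simp; omega,
    Int.card_Ico]
  simp; omega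

namespace Config

/-- If `δ(BC, S) < b + c`, consider the up-pointing triangles below the line `BC` and
between the outer lobes at `B` and `C`, prolonged in the rows below a lobe to the boundary of the
hexagon. In each row, the down-pointing neighbours of these triangles are at most one more than the
triangles if the row ends at two sides of the hexagon, at most as many if it ends at a side and a
lobe, and at most one less if it ends at two lobes; altogether the neighbours exceed the triangles
by at most `δ(BC, S) - b - c < 0`. -/
theorem IsTriadHexagon.depthS_nonneg {R : Config} (h : R.IsTriadHexagon) (ht : R.Tileable) :
    0 ≤ R.depthS := by
  obtain ⟨⟨f, hA, hC, hf⟩, ⟨x, y, z, hs⟩, hl⟩ := h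
  obtain ⟨h₁, h₂, h₃, h₄, h₅, h₆, h₇, h₈, h₉⟩ := (lobes_subset_iff hA hC hf).1 hl
  clear hl
  simp only [Prod.ext_iff] at hA hC
  obtain ⟨hA₁, hA₂⟩ := hA
  obtain ⟨hC₁, hC₂⟩ := hC
  obtain ⟨hs₁, hs₂, hs₃, hs₄, hs₅, hs₆⟩ := hs
  by_contra! hneg
  unfold depthS at hneg
  let L : ℤ → ℤ := fun j => if R.B.2 - R.b ≤ j then R.B.1 else R.hex.sw - j
  let E : ℤ → ℤ := fun j => if R.B.2 - R.c ≤ j then R.C.1 + R.C.2 - j else R.hex.se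
  let L' : ℤ → ℤ := fun j => if R.B.2 - R.b ≤ j then R.B.1 else R.hex.sw - j - 1
  let E' : ℤ → ℤ := fun j => if R.B.2 - R.c ≤ j then R.C.1 + R.C.2 - j - 1 else R.hex.se
  have hle := IsTileable.card_le ht
    (U := (Finset.Ico R.hex.s R.B.2).sigma fun j => Finset.Ico (L j) (E j))
    (D := (Finset.Ico R.hex.s R.B.2).sigma fun j => Finset.Ico (L' j) (E' j)) ?_ ?_
  · have hU := card_rows (s := R.hex.s) (e := R.B.2) (L := L) (E := E) (by
      intro j hj hj'
      dsimp only [L, E]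
      split_ifs <;> omega)
    have hD := card_rows (s := R.hex.s) (e := R.B.2) (L := L') (E := E') (by
      intro j hj hj'
      dsimp only [L', E']
      split_ifs <;> omega)
    have hdiff : ∀ j, E' j - L' j = (E j - L j) + 1 - (if R.B.2 - R.b ≤ j then (1 : ℤ) else 0)
        - (if R.B.2 - R.c ≤ j then (1 : ℤ) else 0) := by
      intro j
      dsimp only [L, E, L', E']
      split_ifs <;> ring
    simp only [hdiff, Finset.sum_sub_distrib, Finset.sum_add_distrib] at hD
    rw [Finset.sum_sub_distrib] at hU
    rw [sum_ite_le (by omega) (by omega), sum_ite_le (by omega) (by omega)] at hD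
    simp only [Finset.sum_const, Int.card_Ico, nsmul_eq_mul, mul_one] at hD
    omega
  · intro i j hij
    simp only [Finset.mem_sigma, Finset.mem_Ico, L, E] at hij
    rw [up_mem_region]
    obtain ⟨⟨hj₁, hj₂⟩, hi₁, hi₂⟩ := hij
    split_ifs at hi₁ hi₂ <;>
      refine ⟨⟨?_, ?_, ?_, ?_, ?_, ?_⟩, ?_, ?_, ?_, ?_, ?_, ?_⟩ <;> omega
  · intro i j hij k l hkl hnb
    simp only [Finset.mem_sigma, Finset.mem_Ico, L, E, L', E'] at hij ⊢
    rw [down_mem_region] at hkl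
    obtain ⟨hhex, -, hB, hC, -⟩ := hkl
    obtain ⟨⟨hj₁, hj₂⟩, hi₁, hi₂⟩ := hij
    obtain ⟨rfl, rfl⟩ | ⟨rfl, rfl⟩ | ⟨rfl, rfl⟩ := hnb
    all_goals
      refine ⟨⟨?_, ?_⟩, ?_, ?_⟩
      · omega
      · omega
      · split_ifs at hi₁ ⊢ <;> omega
      · split_ifs at hi₂ ⊢ <;> omega

theorem IsTriadHexagon.depths_nonneg {R : Config} (h : R.IsTriadHexagon) (ht : R.Tileable) :
    0 ≤ R.depthS ∧ 0 ≤ R.depthNE ∧ 0 ≤ R.depthNW := by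
  refine ⟨h.depthS_nonneg ht, ?_, ?_⟩
  · obtain ⟨f, hA, hC, -⟩ := h.1
    rw [← depthS_rot_rot (by rw [hA, hC]; ring)]
    exact h.rot.rot.depthS_nonneg ht.rot.rot
  · rw [← depthS_rot]
    exact h.rot.depthS_nonneg ht.rot


/-! ### Squeezing -/

theorem depths_eq_of_squeezeOut {R Q : Config} (h : R.SqueezeOut Q) :
    Q.depthS = R.depthS ∧ Q.depthNE = R.depthNE ∧ Q.depthNW = R.depthNW := by
  obtain ⟨d, ⟨hd, rfl⟩ | ⟨hd, rfl⟩ | ⟨hd, rfl⟩⟩ := h <;>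
    simp only [depthS, depthNE, depthNW] <;> omega

theorem depths_eq_of_squeeze {R Q : Config} (h : R.Squeeze Q) :
    Q.depthS = R.depthS ∧ Q.depthNE = R.depthNE ∧ Q.depthNW = R.depthNW := by
  obtain h | h := h
  · exact depths_eq_of_squeezeOut h
  · obtain ⟨h₁, h₂, h₃⟩ := depths_eq_of_squeezeOut h
    exact ⟨h₁.symm, h₂.symm, h₃.symm⟩

theorem IsSlack.isTriadHexagon {R : Config} {f p q r α β γ : ℕ}
    (h : R.IsSlack f p q r α β γ) : R.IsTriadHexagon := by
  obtain ⟨hA₁, hA₂, hC₁, hC₂, hn, hs, hnw, hse, hsw, hne, hf, hx, hy, hz, hi⟩ := h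
  have hA : R.A = (R.B.1, R.B.2 + f) := Prod.ext hA₁ hA₂
  have hC : R.C = (R.B.1 + f, R.B.2) := Prod.ext hC₁ hC₂
  have hf' : R.a' + R.b' + R.c' ≤ f := by omega
  refine ⟨⟨f, hA, hC, hf'⟩, ⟨p + q - α, q + r - β, p + r - γ, ?_⟩,
    (lobes_subset_iff hA hC hf').2 ?_⟩
  · refine ⟨?_, ?_, ?_, ?_, ?_, ?_⟩ <;> omega
  · constructor <;> omega

/-- The slacks do not change, and the focal distance changes by the same amount as `a' + b' + c'`;
so squeezing leads from a hexagon with nonnegative slacks to another one. -/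
theorem IsSlack.exists_of_squeeze {R Q : Config} {f p q r α β γ : ℕ}
    (h : R.IsSlack f p q r α β γ) (hRQ : R.Squeeze Q) : ∃ g, Q.IsSlack g p q r α β γ := by
  obtain ⟨hA₁, hA₂, hC₁, hC₂, hn, hs, hnw, hse, hsw, hne, hf, hx, hy, hz, hi⟩ := h
  obtain ⟨d, ⟨hd, rfl⟩ | ⟨hd, rfl⟩ | ⟨hd, rfl⟩⟩ | ⟨d, ⟨hd, rfl⟩ | ⟨hd, rfl⟩ | ⟨hd, rfl⟩⟩ := hRQ
  · refine ⟨f - d, ?_⟩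
    constructor <;> (try dsimp only) <;> omega
  · refine ⟨f - d, ?_⟩
    constructor <;> (try dsimp only) <;> omega
  · refine ⟨f - d, ?_⟩
    constructor <;> (try dsimp only) <;> omega
  all_goals
    dsimp only at hA₁ hA₂ hC₁ hC₂ hn hs hnw hse hsw hne hf
    refine ⟨f + d, ?_⟩
    constructor <;> omega

end Config

/-! ### Pulling in two adjacent sides -/

/-- The strip of unit width along the northern and the northeastern side of a hexagon. -/
theorem isTileable_strip_N_NE {H H' : Hexagon}
    (hH' : H' = { H with n := H.n - 1, ne := H.ne - 1 })
    (hN : 0 ≤ H.ne - H.n - H.nw) (hNE : 0 ≤ H.se - (H.ne - H.n))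
    (hSE : 1 ≤ H.ne - H.se - H.s) (hNW : 1 ≤ H.n - (H.sw - H.nw)) :
    IsTileable (trianglesIn H.points \ trianglesIn H'.points) := by
  subst hH'
  obtain ⟨u, hu⟩ := Int.eq_ofNat_of_zero_le hN
  obtain ⟨v, hv⟩ := Int.eq_ofNat_of_zero_le hNE
  refine .of_partition (isTileable_symHex H.nw (H.n - 1) u 0 1)
    (isTileable_symHex (H.ne - H.n) (H.ne - H.se - 1) 0 v 1) (fun i j => ?_) fun i j => ?_
  · simp only [Set.mem_sdiff, up_mem_trianglesIn_hexagon, up_mem_symHex]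
    omega
  · simp only [Set.mem_sdiff, down_mem_trianglesIn_hexagon, down_mem_symHex]
    omega

/-- The strip of unit width along the northern and the northwestern side of a hexagon. -/
theorem isTileable_strip_N_NW {H H' : Hexagon}
    (hH' : H' = { H with n := H.n - 1, nw := H.nw + 1 })
    (hN : 0 ≤ H.ne - H.n - H.nw) (hNE : 1 ≤ H.se - (H.ne - H.n))
    (hSW : 1 ≤ H.sw - H.s - H.nw) (hNW : 0 ≤ H.n - (H.sw - H.nw)) :
    IsTileable (trianglesIn H.points \ trianglesIn H'.points) := by
  subst hH'
  obtain ⟨u, hu⟩ := Int.eq_ofNat_of_zero_le hN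
  obtain ⟨w, hw⟩ := Int.eq_ofNat_of_zero_le hNW
  refine .of_partition (isTileable_symHex H.nw (H.n - 1) u 1 0)
    (isTileable_symHex H.nw (H.sw - H.nw - 1) 0 1 w) (fun i j => ?_) fun i j => ?_
  · simp only [Set.mem_sdiff, up_mem_trianglesIn_hexagon, up_mem_symHex]
    omega
  · simp only [Set.mem_sdiff, down_mem_trianglesIn_hexagon, down_mem_symHex]
    omega

theorem trianglesIn_mono {K K' : Set (ℤ × ℤ)} (h : K ⊆ K') : trianglesIn K ⊆ trianglesIn K' :=
  fun _ ht P hP => h (ht P hP)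

namespace Config

/-- A tiling of the region with a smaller hexagon, together with a tiling of the part of the
hexagon that is cut off, is a tiling of the region. -/
theorem tileable_of_hexagon_subset {R : Config} {H : Hexagon}
    (hH : H.points ⊆ R.hex.points)
    (hs : IsTileable (trianglesIn R.hex.points \ trianglesIn H.points))
    (hR : IsTriadHexagon { R with hex := H }) (h : Tileable { R with hex := H }) :
    R.Tileable := by
  have hl : ∀ K ∈ R.lobes, K ⊆ H.points := hR.2.2
  have : IsTileable (_ ∪ _) := IsTileable.union h hs fun t ht ht' => ht'.2 ht.1
  refine (congrArg IsTileable ?_).mp this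
  ext t
  have hsub := @trianglesIn_mono _ _ hH t
  have hlt : (t ∈ ⋃ K ∈ R.lobes, trianglesIn K) → t ∈ trianglesIn H.points := by
    simp only [Set.mem_iUnion]
    rintro ⟨K, hK, ht⟩
    exact trianglesIn_mono (hl K hK) ht
  simp only [region, Set.mem_union, Set.mem_sdiff]
  change _ ∧ ¬ (t ∈ ⋃ K ∈ R.lobes, trianglesIn K) ∨ _ ↔ _
  tauto

theorem IsSlack.rot {R : Config} {f p q r α β γ : ℕ} (h : R.IsSlack f p q r α β γ) :
    R.rot.IsSlack f r p q γ α β := by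
  obtain ⟨hA₁, hA₂, hC₁, hC₂, hn, hs, hnw, hse, hsw, hne, hf, hx, hy, hz, hi⟩ := h
  constructor <;> (try simp only [Config.rot, rotPoint]) <;> omega

/-- If the outer lobe at `A` does not touch the northern side, the northern side can be pulled in
together with the northeastern or the northwestern one: if `p ≥ 1` and `z ≥ 1` the former is
possible, and otherwise `q ≥ 1` and `y ≥ 1`. -/
theorem IsSlack.tileable_of_pull {R : Config} {f p q r α β γ : ℕ}
    (h : R.IsSlack f p q r (α + 1) β γ)
    (ih : ∀ (Q : Config) (p' q' : ℕ), Q.IsSlack f p' q' r α β γ → Q.Tileable) : R.Tileable := by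
  obtain ⟨hA₁, hA₂, hC₁, hC₂, hn, hs, hnw, hse, hsw, hne, hf, hx, hy, hz, hi⟩ := h
  by_cases hpz : 1 ≤ p ∧ γ + 1 ≤ p + r
  · have hQ : IsSlack { R with hex := { R.hex with n := R.hex.n - 1, ne := R.hex.ne - 1 } }
        f (p - 1) q r α β γ := by
      constructor <;> (try dsimp only) <;> omega
    refine tileable_of_hexagon_subset ?_ (isTileable_strip_N_NE rfl ?_ ?_ ?_ ?_)
      hQ.isTriadHexagon (ih _ _ _ hQ)
    · rintro ⟨i, j⟩
      simp only [Hexagon.points, Set.mem_ofPred_eq]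
      omega
    all_goals omega
  · have hQ : IsSlack { R with hex := { R.hex with n := R.hex.n - 1, nw := R.hex.nw + 1 } }
        f p (q - 1) r α β γ := by
      constructor <;> (try dsimp only) <;> omega
    refine tileable_of_hexagon_subset ?_ (isTileable_strip_N_NW rfl ?_ ?_ ?_ ?_)
      hQ.isTriadHexagon (ih _ _ _ hQ)
    · rintro ⟨i, j⟩
      simp only [Hexagon.points, Set.mem_ofPred_eq]
      omega
    all_goals omega

end Config

/-! ### The case that the outer lobes touch the sides facing them -/

/-- The hexagon with right side `AB` of length `t + q + m`, where `P = B`, that lies between the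
line `AB` and the northwestern side of the triad hexagon, and between the outer lobes at `A` and
`B` of sides `a` and `b`. -/
def wingHexagon (P : ℤ × ℤ) (a b q t m : ℕ) : Hexagon where
  n := P.2 + t + q + m + a
  s := P.2
  nw := P.1 - a - b - q
  se := P.1
  sw := P.1 + P.2 - b
  ne := P.1 + P.2 + t + q + m

/-- The hexagon between `AB` and the northwestern side has `q` more down-pointing than up-pointing
triangles. A rhombus of side `q`, which has one of its diagonals on `AB` at distance `t` from `B`
and `m` from `A`, restores the balance. -/
def wing (P : ℤ × ℤ) (a b q t m : ℕ) : Set UnitTriangle :=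
  trianglesIn (wingHexagon P a b q t m).points ∪ symHex (P.1 - q) (P.2 + t) q q 0

/-- Outside the rhombus, the wing consists of a hexagon at its southern end, a parallelogram along
the northwestern side, and a hexagon at its northern end. -/
theorem isTileable_wing (P : ℤ × ℤ) (a b q t m : ℕ) : IsTileable (wing P a b q t m) := by
  obtain ⟨u, v⟩ := P
  have h₁ := isTileable_symHex (u - a - b - q) v b (a + q) t
  have h₂ := isTileable_symHex (u - a - b - q) (v + a + q + t) b 0 m
  have h₃ := isTileable_symHex (u - a - q) (v + t + q) q a m
  have h₄ := isTileable_symHex (u - q) (v + t) q q 0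
  have h₁₂ := h₁.union h₂ (by
    rintro (⟨i, j⟩ | ⟨i, j⟩)
    · rw [up_mem_symHex, up_mem_symHex]; omega
    · rw [down_mem_symHex, down_mem_symHex]; omega)
  have h₃₄ := h₃.union h₄ (by
    rintro (⟨i, j⟩ | ⟨i, j⟩)
    · rw [up_mem_symHex, up_mem_symHex]; omega
    · rw [down_mem_symHex, down_mem_symHex]; omega)
  refine .of_partition h₁₂ h₃₄ (fun i j => ?_) fun i j => ?_
  · simp only [wing, Set.mem_union, up_mem_symHex, up_mem_trianglesIn_hexagon, wingHexagon]
    omega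
  · simp only [wing, Set.mem_union, down_mem_symHex, down_mem_trianglesIn_hexagon, wingHexagon]
    omega

/-- The up-pointing triangle `ABC` with `P = B`, without six up-pointing triangles along its
boundary whose sides add up to the side of `ABC`: the inner lobes of sides `a'`, `b'`, `c'` in the
angles, and triangles of sides `p` on `AC`, `q` on `AB`, `r` on `BC`. The triangle on `BC` touches
the lobe at `B`; the other two have their lower ends at height `b' + r + c'` above `BC`. -/
def focalCore (P : ℤ × ℤ) (a' b' c' p q r : ℕ) : Set UnitTriangle :=
  trianglesIn (upPoints P (a' + b' + c' + p + q + r)) \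
    (trianglesIn (upPoints (P.1, P.2 + b' + c' + r + p + q) a') ∪ trianglesIn (upPoints P b') ∪
      trianglesIn (upPoints (P.1 + a' + b' + p + q + r, P.2) c') ∪
      trianglesIn (upPoints (P.1 + a' + q, P.2 + b' + c' + r) p) ∪
      trianglesIn (upPoints (P.1, P.2 + b' + c' + r) q) ∪
      trianglesIn (upPoints (P.1 + b', P.2) r))

/-- The horizontal line at height `b' + r + c'` above `BC` cuts the core into a hexagon, and a
trapezoid with dents; between the dents of sides `b'` and `r` the latter has a parallelogram, and
the rest of it is a hexagon. -/
theorem isTileable_focalCore (P : ℤ × ℤ) (a' b' c' p q r : ℕ) :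
    IsTileable (focalCore P a' b' c' p q r) := by
  obtain ⟨u, v⟩ := P
  have h₁ := isTileable_symHex u (v + b' + c' + r) a' q p
  have h₂ := isTileable_symHex u v (a' + p + q) (b' + r) c'
  have h₃ := isTileable_symHex u v 0 b' r
  have h₂₃ := h₂.union h₃ (by
    rintro (⟨i, j⟩ | ⟨i, j⟩)
    · rw [up_mem_symHex, up_mem_symHex]; omega
    · rw [down_mem_symHex, down_mem_symHex]; omega)
  refine .of_partition h₁ h₂₃ (fun i j => ⟨?_, ?_⟩) fun i j => ⟨?_, ?_⟩
  · simp only [focalCore, Set.mem_union, Set.mem_sdiff, not_or, up_mem_symHex,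
      up_mem_trianglesIn_upPoints]
    constructor
    · rintro ⟨h, ⟨⟨⟨⟨h₁, h₂⟩, h₃⟩, h₄⟩, h₅⟩, h₆⟩
      by_cases hj : v + b' + c' + r ≤ j
      · omega
      · right; omega
    · rintro (h | h | h) <;>
        refine ⟨by omega, ⟨⟨⟨⟨by omega, by omega⟩, by omega⟩, by omega⟩, by omega⟩, by omega⟩
  · simp only [Set.mem_union, up_mem_symHex]
    omega
  · simp only [focalCore, Set.mem_union, Set.mem_sdiff, not_or, down_mem_symHex,
      down_mem_trianglesIn_upPoints]
    constructor
    · rintro ⟨h, ⟨⟨⟨⟨h₁, h₂⟩, h₃⟩, h₄⟩, h₅⟩, h₆⟩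
      by_cases hj : v + b' + c' + r ≤ j
      · omega
      · right; omega
    · rintro (h | h | h) <;>
        refine ⟨by omega, ⟨⟨⟨⟨by omega, by omega⟩, by omega⟩, by omega⟩, by omega⟩, by omega⟩
  · simp only [Set.mem_union, down_mem_symHex]
    omega

namespace Config

/-- The wings on the three sides `AB`, `AC`, `BC` of the triangle `ABC`. -/
def wings (R : Config) (p q r : ℕ) : Set UnitTriangle :=
  wing R.B R.a R.b q (R.b' + R.c' + r) (R.a' + p) ∪
    (UnitTriangle.rot ⁻¹' wing (rotPoint R.A) R.c R.a p (R.a' + q) (R.b' + R.c' + r) ∪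
      UnitTriangle.rot ⁻¹' (UnitTriangle.rot ⁻¹'
        wing (rotPoint (rotPoint R.C)) R.b R.c r (R.a' + R.c' + p + q) R.b'))

theorem IsSlack.isTileable_wings {R : Config} {f p q r : ℕ} (h : R.IsSlack f p q r 0 0 0) :
    IsTileable (R.wings p q r) := by
  obtain ⟨hA₁, hA₂, hC₁, hC₂, -, -, -, -, -, -, hf, -, -, -, -⟩ := h
  refine (isTileable_wing _ _ _ _ _ _).union
    ((isTileable_wing _ _ _ _ _ _).preimage_rot.union
      (isTileable_wing _ _ _ _ _ _).preimage_rot.preimage_rot ?_) ?_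
  · rintro (⟨i, j⟩ | ⟨i, j⟩)
    · simp only [wing, Set.mem_preimage, UnitTriangle.rot, Set.mem_union, up_mem_symHex,
        up_mem_trianglesIn_hexagon, wingHexagon, rotPoint, hA₁, hA₂, hC₁, hC₂]
      omega
    · simp only [wing, Set.mem_preimage, UnitTriangle.rot, Set.mem_union, down_mem_symHex,
        down_mem_trianglesIn_hexagon, wingHexagon, rotPoint, hA₁, hA₂, hC₁, hC₂]
      omega
  · rintro (⟨i, j⟩ | ⟨i, j⟩)
    · simp only [wing, Set.mem_preimage, UnitTriangle.rot, Set.mem_union, up_mem_symHex,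
        up_mem_trianglesIn_hexagon, wingHexagon, rotPoint, hA₁, hA₂, hC₁, hC₂]
      omega
    · simp only [wing, Set.mem_preimage, UnitTriangle.rot, Set.mem_union, down_mem_symHex,
        down_mem_trianglesIn_hexagon, wingHexagon, rotPoint, hA₁, hA₂, hC₁, hC₂]
      omega

theorem IsSlack.up_mem_region_iff {R : Config} {f p q r : ℕ} (h : R.IsSlack f p q r 0 0 0)
    (i j : ℤ) : UnitTriangle.up i j ∈ R.region ↔
      UnitTriangle.up i j ∈ focalCore R.B R.a' R.b' R.c' p q r ∨
        UnitTriangle.up i j ∈ R.wings p q r := by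
  obtain ⟨hA₁, hA₂, hC₁, hC₂, hn, hs, hnw, hse, hsw, hne, hf, -, -, -, -⟩ := h
  simp only [wings, wing, focalCore, Set.mem_preimage, UnitTriangle.rot, Set.mem_union,
    Set.mem_sdiff, not_or, up_mem_symHex, up_mem_trianglesIn_hexagon, wingHexagon, rotPoint,
    up_mem_trianglesIn_upPoints, up_mem_region, hA₁, hA₂, hC₁, hC₂, hn, hs, hnw, hse, hsw, hne]
  clear hA₁ hA₂ hC₁ hC₂ hn hs hnw hse hsw hne
  generalize R.B.1 = u at *
  generalize R.B.2 = v at *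
  constructor
  · rintro ⟨h, nA, nB, nC, nA', nB', nC'⟩
    refine or_iff_not_imp_right.2 fun hw => ?_
    simp only [not_or] at hw
    obtain ⟨⟨w₁, r₁⟩, ⟨w₂, r₂⟩, w₃, r₃⟩ := hw
    have hi : u ≤ i := by clear nC nA' nB' nC' r₁ r₂ r₃ w₂ w₃; omega
    have hj : v ≤ j := by clear nA nA' nB' nC' r₁ r₂ r₃ w₁ w₂; omega
    clear w₁ w₃ nB
    refine ⟨⟨hi, hj, ?_⟩, ⟨⟨⟨⟨?_, nB'⟩, ?_⟩, ?_⟩, ?_⟩, ?_⟩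
    · clear nA' nB' nC' r₁ r₂ r₃; omega
    · clear nA nC nB' nC' r₁ r₂ r₃ w₂; omega
    · clear nA nC nB' nA' r₁ r₂ r₃ w₂; omega
    · clear nA nC nB' nC' nA' r₁ r₃ w₂; omega
    · clear nA nC nB' nC' nA' r₂ r₃ w₂; omega
    · clear nA nC nB' nC' nA' r₁ r₂ w₂; omega
  · rintro (⟨h, ⟨⟨⟨⟨g₁, g₂⟩, g₃⟩, -⟩, -⟩, -⟩ | (h | h) | (h | h) | (h | h))
    · refine ⟨?_, ?_, ?_, ?_, ?_, g₂, ?_⟩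
      · clear g₁ g₂ g₃; omega
      · clear g₁ g₂ g₃; omega
      · clear g₁ g₂ g₃; omega
      · clear g₁ g₂ g₃; omega
      · clear g₂ g₃; omega
      · clear g₁ g₂; omega
    all_goals refine ⟨by omega, by omega, by omega, by omega, by omega, by omega, by omega⟩

theorem IsSlack.down_mem_region_iff {R : Config} {f p q r : ℕ} (h : R.IsSlack f p q r 0 0 0)
    (i j : ℤ) : UnitTriangle.down i j ∈ R.region ↔
      UnitTriangle.down i j ∈ focalCore R.B R.a' R.b' R.c' p q r ∨
        UnitTriangle.down i j ∈ R.wings p q r := by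
  obtain ⟨hA₁, hA₂, hC₁, hC₂, hn, hs, hnw, hse, hsw, hne, hf, -, -, -, -⟩ := h
  simp only [wings, wing, focalCore, Set.mem_preimage, UnitTriangle.rot, Set.mem_union,
    Set.mem_sdiff, not_or, down_mem_symHex, down_mem_trianglesIn_hexagon, wingHexagon, rotPoint,
    down_mem_trianglesIn_upPoints, down_mem_region, hA₁, hA₂, hC₁, hC₂, hn, hs, hnw, hse, hsw, hne]
  clear hA₁ hA₂ hC₁ hC₂ hn hs hnw hse hsw hne
  generalize R.B.1 = u at *
  generalize R.B.2 = v at *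
  constructor
  · rintro ⟨h, nA, nB, nC, nA', nB', nC'⟩
    refine or_iff_not_imp_right.2 fun hw => ?_
    simp only [not_or] at hw
    obtain ⟨⟨w₁, r₁⟩, ⟨w₂, r₂⟩, w₃, r₃⟩ := hw
    have hi : u ≤ i := by clear nC nA' nB' nC' r₁ r₂ r₃ w₂ w₃; omega
    have hj : v ≤ j := by clear nA nA' nB' nC' r₁ r₂ r₃ w₁ w₂; omega
    clear w₁ w₃ nB
    refine ⟨⟨hi, hj, ?_⟩, ⟨⟨⟨⟨?_, nB'⟩, ?_⟩, ?_⟩, ?_⟩, ?_⟩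
    · clear nA' nB' nC' r₁ r₂ r₃; omega
    · clear nA nC nB' nC' r₁ r₂ r₃ w₂; omega
    · clear nA nC nB' nA' r₁ r₂ r₃ w₂; omega
    · clear nA nC nB' nC' nA' r₁ r₃ w₂; omega
    · clear nA nC nB' nC' nA' r₂ r₃ w₂; omega
    · clear nA nC nB' nC' nA' r₁ r₂ w₂; omega
  · rintro (⟨h, ⟨⟨⟨⟨g₁, g₂⟩, g₃⟩, -⟩, -⟩, -⟩ | (h | h) | (h | h) | (h | h))
    · refine ⟨?_, ?_, ?_, ?_, ?_, g₂, ?_⟩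
      · clear g₁ g₂ g₃; omega
      · clear g₁ g₂ g₃; omega
      · clear g₁ g₂ g₃; omega
      · clear g₁ g₂ g₃; omega
      · clear g₂ g₃; omega
      · clear g₁ g₂; omega
    all_goals refine ⟨by omega, by omega, by omega, by omega, by omega, by omega, by omega⟩

/-- The three wings and the focal core partition the region; the rhombus of each wing covers the
triangle on that side of `ABC` that the focal core omits. -/
theorem IsSlack.tileable_of_touching {R : Config} {f p q r : ℕ}
    (h : R.IsSlack f p q r 0 0 0) : R.Tileable := by
  refine IsTileable.of_partition (isTileable_focalCore R.B R.a' R.b' R.c' p q r)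
    h.isTileable_wings (fun i j => ⟨h.up_mem_region_iff i j, ?_⟩)
    fun i j => ⟨h.down_mem_region_iff i j, ?_⟩ <;>
  obtain ⟨hA₁, hA₂, hC₁, hC₂, -, -, -, -, -, -, hf, -, -, -, -⟩ := h
  · simp only [wings, wing, focalCore, Set.mem_preimage, UnitTriangle.rot, Set.mem_union,
      Set.mem_sdiff, not_or, up_mem_symHex, up_mem_trianglesIn_hexagon, wingHexagon, rotPoint,
      up_mem_trianglesIn_upPoints, hA₁, hA₂, hC₁, hC₂]
    rintro ⟨⟨h, ⟨⟨⟨⟨g₁, g₂⟩, g₃⟩, g₄⟩, g₅⟩, g₆⟩, (h' | h') | (h' | h') | (h' | h')⟩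
    · clear g₁ g₂ g₃ g₄ g₅ g₆; omega
    · clear g₁ g₂ g₃ g₄ g₆; omega
    · clear g₁ g₂ g₃ g₄ g₅ g₆; omega
    · clear g₁ g₂ g₃ g₅ g₆; omega
    · clear g₁ g₂ g₃ g₄ g₅ g₆; omega
    · clear g₁ g₂ g₃ g₄ g₅; omega
  · simp only [wings, wing, focalCore, Set.mem_preimage, UnitTriangle.rot, Set.mem_union,
      Set.mem_sdiff, not_or, down_mem_symHex, down_mem_trianglesIn_hexagon, wingHexagon, rotPoint,
      down_mem_trianglesIn_upPoints, hA₁, hA₂, hC₁, hC₂]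
    rintro ⟨⟨h, ⟨⟨⟨⟨g₁, g₂⟩, g₃⟩, g₄⟩, g₅⟩, g₆⟩, (h' | h') | (h' | h') | (h' | h')⟩
    · clear g₁ g₂ g₃ g₄ g₅ g₆; omega
    · clear g₁ g₂ g₃ g₄ g₆; omega
    · clear g₁ g₂ g₃ g₄ g₅ g₆; omega
    · clear g₁ g₂ g₃ g₅ g₆; omega
    · clear g₁ g₂ g₃ g₄ g₅ g₆; omega
    · clear g₁ g₂ g₃ g₄ g₅; omega

theorem IsSlack.tileable {R : Config} {f p q r α β γ : ℕ} (h : R.IsSlack f p q r α β γ) :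
    R.Tileable := by
  induction hm : α + β + γ generalizing R f p q r α β γ with
  | zero =>
    obtain ⟨⟨rfl, rfl⟩, rfl⟩ : (α = 0 ∧ β = 0) ∧ γ = 0 := by omega
    exact h.tileable_of_touching
  | succ m ih =>
    -- a rotation brings a positive slack to the northern side
    obtain ⟨α, rfl⟩ | ⟨γ, rfl⟩ | ⟨β, rfl⟩ :
        (∃ k, α = k + 1) ∨ (∃ k, γ = k + 1) ∨ ∃ k, β = k + 1 := by
      by_contra! hc
      have := hc.1 (α - 1)
      have := hc.2.1 (γ - 1)
      have := hc.2.2 (β - 1)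
      omega
    · exact h.tileable_of_pull fun Q p' q' hQ => ih hQ (by omega)
    · exact tileable_of_tileable_rot
        (h.rot.tileable_of_pull fun Q p' q' hQ => ih hQ (by omega))
    · exact tileable_of_tileable_rot (tileable_of_tileable_rot
        (h.rot.rot.tileable_of_pull fun Q p' q' hQ => ih hQ (by omega)))

theorem IsTriadHexagon.tileable_iff {R : Config} (h : R.IsTriadHexagon) :
    R.Tileable ↔ 0 ≤ R.depthS ∧ 0 ≤ R.depthNE ∧ 0 ≤ R.depthNW := by
  refine ⟨h.depths_nonneg, fun ⟨h₁, h₂, h₃⟩ => ?_⟩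
  obtain ⟨f, p, q, r, α, β, γ, hR⟩ := h.exists_isSlack h₁ h₂ h₃
  exact hR.tileable

theorem IsSlack.exists_of_reflTransGen {R Q : Config} {f p q r α β γ : ℕ}
    (h : R.IsSlack f p q r α β γ) (hRQ : Relation.ReflTransGen Squeeze R Q) :
    ∃ g, Q.IsSlack g p q r α β γ := by
  induction hRQ with
  | refl => exact ⟨f, h⟩
  | tail _ hs ih =>
    obtain ⟨g, hg⟩ := ih
    exact hg.exists_of_squeeze hs

end Config
end TriadHexagon

theorem lemma2p1 :
    -- (a) a triad hexagon is tileable iff its three depths are nonnegative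
    (∀ R : TriadHexagon.Config, R.IsTriadHexagon →
      (R.Tileable ↔ 0 ≤ R.depthS ∧ 0 ≤ R.depthNE ∧ 0 ≤ R.depthNW)) ∧
    -- (b) the depths are invariant under bowtie squeezing
    (∀ R Q : TriadHexagon.Config, R.IsTriadHexagon → R.Squeeze Q →
      Q.depthS = R.depthS ∧ Q.depthNE = R.depthNE ∧ Q.depthNW = R.depthNW) ∧
    -- (c) sequences of bowtie squeezings turn tileable triad hexagons into tileable triad hexagons
    (∀ R Q : TriadHexagon.Config, R.IsTriadHexagon → R.Tileable →
      Relation.ReflTransGen TriadHexagon.Config.Squeeze R Q →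
      Q.IsTriadHexagon ∧ Q.Tileable) := by
  refine ⟨fun R hR => hR.tileable_iff, fun R Q _ h => TriadHexagon.Config.depths_eq_of_squeeze h,
    fun R Q hR ht h => ?_⟩
  obtain ⟨h₁, h₂, h₃⟩ := hR.depths_nonneg ht
  obtain ⟨f, p, q, r, α, β, γ, hs⟩ := hR.exists_isSlack h₁ h₂ h₃
  obtain ⟨g, hg⟩ := hs.exists_of_reflTransGen h
  exact ⟨hg.isTriadHexagon, hg.tileable⟩
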